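/- Let $\Omega\subset\mathbb R^n$ be open and let $E$ be a bounded open set with $\overline E\subset\Omega$. Let $Q$ be a function from $\Omega$ to the symmetric positive semidefinite real $n\times n$ matrices with Lebesgue measurable entries, write $|\sqrt{Q(x)}\,\xi|=(\xi^tQ(x)\xi)^{1/2}$, and let $\gamma(x)=|Q(x)|_{\mathrm{op}}$. Let $v\ge 0$ be a function in $L^1_{\mathrm{loc}}(\Omega)$, let $v(E)=\int_E v\,dx$, and let $f_E=\frac1{v(E)}\int_E fv\,dx$ (read as $0$ if $v(E)=0$). Let $1<p<\infty$. Let $C^1(\overline E)$ be the set of functions that are continuous on $\overline E$ and $C^1$ in $E$, and whose gradient extends continuously to $\overline E$. Let $L^p(v;E)$ be the space $L^p(E,v\,dx)$ and let $\mathcal L^p_Q(E)$ be the space of measurable $\mathbf g:E\to\mathbb R^n$ with $$\|\mathbf g\|_{\mathcal L^p_Q(E)}=\Big(\int_E|\sqrt{Q}\,\mathbf g|^p\,dx\Big)^{1/p}<\infty,$$ where functions at distance $0$ are identified. Let $H^{1,p}_Q(v;E)$ be the completion of the set of $\varphi\in C^1(\overline E)$ of finite norm $\|\varphi\|_{L^p(v;E)}+\|\nabla\varphi\|_{\mathcal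 L^p_Q(E)}$, whose elements are represented by the pairs $(u,\mathbf g)\in L^p(v;E)\times\mathcal L^p_Q(E)$ that are limits of pairs $(\varphi_k,\nabla\varphi_k)$ with such $\varphi_k$. Let $$\tilde H^{1,p}_Q(v;E)=\Big\{(u,\mathbf g)\in H^{1,p}_Q(v;E):\int_E uv\,dx=0\Big\}.$$ Suppose that $\gamma^{p/2}\in L^1_{\mathrm{loc}}(E)$ and that the quadratic form $\mathcal Q(x,\xi)=\xi^tQ(x)\xi$ has the Poincaré property of order $p$ on $E$: there is a constant $C>0$ such that for all $\varphi\in C^1(\overline E)$ $$\int_E|\varphi-\varphi_E|^pv\,dx\le C\int_E|\sqrt{Q}\,\nabla\varphi|^p\,dx .$$ Then for every $f\in L^p(v;E)$ there is a pair $(u,\mathbf g)\in\tilde H^{1,p}_Q(v;E)$ that is a weak solution of the weighted homogeneous Neumann problem $$\operatorname{div}\big(|\sqrt Q\,\nabla u|^{p-2}Q\nabla u\big)=|f|^{p-2}fv\ \text{ in }E,\qquad \mathbf n^t\cdot Q\nabla u=0\ \text{ on }\partial E,$$ that is, for every $\varphi\in C^1(\overline E)$ with $(\varphi,\nabla\varphi)\in\tilde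 H^{1,p}_Q(v;E)$, both integrands below are integrable and $$\int_E|\sqrt{Q}\,\mathbf g|^{p-2}(\nabla\varphi)^tQ\,\mathbf g\,dx=-\int_E|f|^{p-2}f\varphi v\,dx .$$ Here $|s|^{p-2}s$ is read as $0$ when $s=0$. -/

import Mathlib

open MeasureTheory Filter Topology

noncomputable section

namespace DegenerateNeumann

/-- The bilinear form `ηᵗ A ξ` of a real `n × n` matrix `A`. -/
def bilin {n : ℕ} (A : Matrix (Fin n) (Fin n) ℝ) (η ξ : EuclideanSpace ℝ (Fin n)) : ℝ :=
  η.ofLp ⬝ᵥ (A.mulVec ξ.ofLp)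

/-- `|√A ξ| = (ξᵗ A ξ)^{1/2}`, for a positive semidefinite matrix `A`
(see `sqrtNorm_eq` below). -/
def sqrtNorm {n : ℕ} (A : Matrix (Fin n) (Fin n) ℝ) (ξ : EuclideanSpace ℝ (Fin n)) : ℝ :=
  √(bilin A ξ ξ)

/-- If `S` is a symmetric square root of `A`, then `sqrtNorm A ξ` is the Euclidean norm
of `S ξ`. -/
theorem sqrtNorm_eq {n : ℕ} (A S : Matrix (Fin n) (Fin n) ℝ) (hS : S.IsSymm)
    (hSA : S * S = A) (ξ : EuclideanSpace ℝ (Fin n)) :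
    sqrtNorm A ξ = ‖WithLp.toLp 2 (S.mulVec ξ.ofLp)‖ := by
  rw [EuclideanSpace.norm_eq, sqrtNorm, bilin, ← hSA, ← Matrix.mulVec_mulVec,
    Matrix.dotProduct_mulVec, ← Matrix.mulVec_transpose, hS.eq]
  simp [dotProduct, sq]

/-- The operator norm `γ = |A|_op` of a matrix acting on Euclidean space. -/
def opNorm {n : ℕ} (A : Matrix (Fin n) (Fin n) ℝ) : ℝ :=
  ‖Matrix.toEuclideanCLM (𝕜 := ℝ) A‖

/-- The measure `v dx` on `E`. Thus `L^p(v;E)` is the space of `f` with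
`MemLp f p (weightMeasure v E)`. -/
def weightMeasure {n : ℕ} (v : EuclideanSpace ℝ (Fin n) → ℝ)
    (E : Set (EuclideanSpace ℝ (Fin n))) : Measure (EuclideanSpace ℝ (Fin n)) :=
  (volume.restrict E).withDensity (fun x => ENNReal.ofReal (v x))

/-- `C¹(closure E)`, for an open set `E`: functions that are `C¹` in `E`, continuous on the
closure of `E`, and whose gradient has a continuous extension to the closure of `E`. -/
def IsC1Closure {n : ℕ} (E : Set (EuclideanSpace ℝ (Fin n)))
    (φ : EuclideanSpace ℝ (Fin n) → ℝ) : Prop :=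
  ContDiffOn ℝ 1 φ E ∧ ContinuousOn φ (closure E) ∧
    ∃ G : EuclideanSpace ℝ (Fin n) → EuclideanSpace ℝ (Fin n),
      ContinuousOn G (closure E) ∧ Set.EqOn G (gradient φ) E

/-- The norm `(∫_E |√Q g|^p dx)^{1/p}` of a vector field `g`, with values in `[0,∞]`. -/
def normLQ {n : ℕ} (p : ℝ) (Q : EuclideanSpace ℝ (Fin n) → Matrix (Fin n) (Fin n) ℝ)
    (E : Set (EuclideanSpace ℝ (Fin n)))
    (g : EuclideanSpace ℝ (Fin n) → EuclideanSpace ℝ (Fin n)) : ENNReal :=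
  (∫⁻ x in E, ENNReal.ofReal (sqrtNorm (Q x) (g x) ^ p)) ^ (1 / p)

/-- Membership in `𝓛^p_Q(E)`: Lebesgue measurable vector fields of finite norm. -/
def MemLQ {n : ℕ} (p : ℝ) (Q : EuclideanSpace ℝ (Fin n) → Matrix (Fin n) (Fin n) ℝ)
    (E : Set (EuclideanSpace ℝ (Fin n)))
    (g : EuclideanSpace ℝ (Fin n) → EuclideanSpace ℝ (Fin n)) : Prop :=
  AEMeasurable g (volume.restrict E) ∧ normLQ p Q E g < ⊤

/-- The functions `φ ∈ C¹(closure E)` for which the Sobolev norm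
`‖φ‖_{L^p(v;E)} + ‖∇φ‖_{𝓛^p_Q(E)}` is finite. -/
def IsC1FiniteNorm {n : ℕ} (p : ℝ) (v : EuclideanSpace ℝ (Fin n) → ℝ)
    (Q : EuclideanSpace ℝ (Fin n) → Matrix (Fin n) (Fin n) ℝ)
    (E : Set (EuclideanSpace ℝ (Fin n))) (φ : EuclideanSpace ℝ (Fin n) → ℝ) : Prop :=
  IsC1Closure E φ ∧ MemLp φ (ENNReal.ofReal p) (weightMeasure v E) ∧ MemLQ p Q E (gradient φ)

/-- The pair `(u, g)` (given by representatives) is an element of `H^{1,p}_Q(v;E)`, the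
completion of `C¹(closure E)` in the Sobolev norm: `u ∈ L^p(v;E)`, `g ∈ 𝓛^p_Q(E)`, and `(u, g)`
is the limit of `(φ_k, ∇φ_k)` in `L^p(v;E) × 𝓛^p_Q(E)` for some sequence of functions
`φ_k ∈ C¹(closure E)` of finite Sobolev norm. -/
def MemH {n : ℕ} (p : ℝ) (v : EuclideanSpace ℝ (Fin n) → ℝ)
    (Q : EuclideanSpace ℝ (Fin n) → Matrix (Fin n) (Fin n) ℝ)
    (E : Set (EuclideanSpace ℝ (Fin n))) (u : EuclideanSpace ℝ (Fin n) → ℝ)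
    (g : EuclideanSpace ℝ (Fin n) → EuclideanSpace ℝ (Fin n)) : Prop :=
  MemLp u (ENNReal.ofReal p) (weightMeasure v E) ∧ MemLQ p Q E g ∧
    ∃ φ : ℕ → EuclideanSpace ℝ (Fin n) → ℝ,
      (∀ k, IsC1FiniteNorm p v Q E (φ k)) ∧
      Tendsto (fun k => eLpNorm (φ k - u) (ENNReal.ofReal p) (weightMeasure v E)) atTop (𝓝 0) ∧
      Tendsto (fun k => normLQ p Q E (gradient (φ k) - g)) atTop (𝓝 0)

/-- Membership in the mean-zero subspace of `H^{1,p}_Q(v;E)`, i.e. `∫_E u v dx = 0`. -/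
def MemHTilde {n : ℕ} (p : ℝ) (v : EuclideanSpace ℝ (Fin n) → ℝ)
    (Q : EuclideanSpace ℝ (Fin n) → Matrix (Fin n) (Fin n) ℝ)
    (E : Set (EuclideanSpace ℝ (Fin n))) (u : EuclideanSpace ℝ (Fin n) → ℝ)
    (g : EuclideanSpace ℝ (Fin n) → EuclideanSpace ℝ (Fin n)) : Prop :=
  MemH p v Q E u g ∧ ∫ x, u x ∂(weightMeasure v E) = 0

/-- The Poincaré property of order `p` on `E`. Both sides are integrals with values in `[0,∞]`;
`⨍ y, f y ∂(weightMeasure v E)` is the weighted average `f_E`. -/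
def PoincareProperty {n : ℕ} (p : ℝ) (v : EuclideanSpace ℝ (Fin n) → ℝ)
    (Q : EuclideanSpace ℝ (Fin n) → Matrix (Fin n) (Fin n) ℝ)
    (E : Set (EuclideanSpace ℝ (Fin n))) : Prop :=
  ∃ C : ℝ, 0 < C ∧ ∀ f : EuclideanSpace ℝ (Fin n) → ℝ, IsC1Closure E f →
    ∫⁻ x, ENNReal.ofReal (|f x - ⨍ y, f y ∂(weightMeasure v E)| ^ p) ∂(weightMeasure v E)
      ≤ ENNReal.ofReal C * ∫⁻ x in E, ENNReal.ofReal (sqrtNorm (Q x) (gradient f x) ^ p)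

/-- The element `(u, g)` of the mean-zero space is a weak solution, with data `f`,
of the weighted homogeneous Neumann problem for
`div (|√Q ∇u|^{p-2} Q ∇u) = |f|^{p-2} f v` in `E`. The test functions are the `φ` in
`C¹(closure E)` for which `(φ, ∇φ)` is in the mean-zero space. Here `|s|^{p-2} s` is read as `0`
for `s = 0`, also when `p < 2`. The integral identity involves only the component `g` of the pair. -/
def IsWeakSolution {n : ℕ} (p : ℝ) (v : EuclideanSpace ℝ (Fin n) → ℝ)
    (Q : EuclideanSpace ℝ (Fin n) → Matrix (Fin n) (Fin n) ℝ)
    (E : Set (EuclideanSpace ℝ (Fin n))) (f : EuclideanSpace ℝ (Fin n) → ℝ)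
    (g : EuclideanSpace ℝ (Fin n) → EuclideanSpace ℝ (Fin n)) : Prop :=
  ∀ φ : EuclideanSpace ℝ (Fin n) → ℝ, IsC1Closure E φ → MemHTilde p v Q E φ (gradient φ) →
    IntegrableOn
      (fun x => sqrtNorm (Q x) (g x) ^ (p - 2) * bilin (Q x) (gradient φ x) (g x)) E ∧
    Integrable (fun x => |f x| ^ (p - 2) * f x * φ x) (weightMeasure v E) ∧
    ∫ x in E, sqrtNorm (Q x) (g x) ^ (p - 2) * bilin (Q x) (gradient φ x) (g x)
      = -∫ x, |f x| ^ (p - 2) * f x * φ x ∂(weightMeasure v E)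

end DegenerateNeumann

end

noncomputable section

namespace DegenerateNeumann

/-! ### Pointwise convexity and growth estimates for `‖·‖ ^ p`. -/

section Pointwise

variable {H : Type*} [NormedAddCommGroup H] [InnerProductSpace ℝ H]

/-! The solution comes from minimizing `J φ = (1/p) ∫_E |√Q ∇φ|^p dx + ∫_E |f|^{p-2} f φ v dx` over
the mean-zero `φ` in `C¹(closure E)` of finite norm. The field `√Q ∇φ` lies in an ordinary
vector-valued `L^p`, so the degeneracy of `Q` is absorbed into the linear map `T φ = √Q ∇φ`. By
Hölder and the Poincaré property the linear term is bounded by a multiple of `‖T φ‖`, hence `J` is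
bounded below and minimizing sequences have bounded `T φ_k`.

No weak compactness is needed. A quantitative midpoint convexity of `‖·‖ ^ p`
(`exists_norm_sub_rpow_le`) integrates to `L^p` and makes `T φ_k` Cauchy. Its limit `h` minimizes
the energy along every line `h + t • T ψ`, which yields the Euler–Lagrange equation
(`exists_tendsto_eulerLagrange`).

It remains to return to the Sobolev space. The Poincaré property makes `φ_k` Cauchy in `L^p(v;E)`,
which gives `u`. The limit `h` has the form `√Q g`, because fields with values in the range of `√Q`
form a closed set and the pseudoinverse of `√Q` is measurable (`exists_rootField_eq_of_tendsto`). -/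

theorem norm_half_add_le (a b : H) : ‖(1 / 2 : ℝ) • (a + b)‖ ≤ (‖a‖ + ‖b‖) / 2 := by
  rw [norm_smul]
  have := norm_add_le a b
  norm_num
  linarith

theorem norm_half_add_rpow_le {p : ℝ} (hp : 1 < p) (a b : H) :
    ‖(1 / 2 : ℝ) • (a + b)‖ ^ p ≤ (‖a‖ ^ p + ‖b‖ ^ p) / 2 := by
  have h1 := Real.rpow_le_rpow (norm_nonneg _) (norm_half_add_le a b) (by linarith : 0 ≤ p)
  have h2 := (convexOn_rpow hp.le).2 (norm_nonneg a) (norm_nonneg b)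
    (by norm_num : (0 : ℝ) ≤ 1 / 2) (by norm_num : (0 : ℝ) ≤ 1 / 2) (by norm_num)
  simp only [smul_eq_mul] at h2
  have h3 : 1 / 2 * ‖a‖ + 1 / 2 * ‖b‖ = (‖a‖ + ‖b‖) / 2 := by ring
  rw [h3] at h2
  linarith

/-- Strictness has two sources: strict convexity of the Hilbert norm when `‖a‖ = ‖b‖`, and strict
convexity of `t ↦ t ^ p` otherwise. -/
theorem norm_half_add_rpow_lt {p : ℝ} (hp : 1 < p) {a b : H} (hab : a ≠ b) :
    ‖(1 / 2 : ℝ) • (a + b)‖ ^ p < (‖a‖ ^ p + ‖b‖ ^ p) / 2 := by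
  by_cases h : ‖a‖ = ‖b‖
  · have h1 : ‖(1 / 2 : ℝ) • a + (1 / 2 : ℝ) • b‖ < ‖a‖ :=
      norm_combo_lt_of_ne le_rfl h.ge hab (by norm_num) (by norm_num) (by norm_num)
    rw [← smul_add] at h1
    have := Real.rpow_lt_rpow (norm_nonneg _) h1 (by linarith : 0 < p)
    rw [← h]
    linarith
  · have h1 := Real.rpow_le_rpow (norm_nonneg _) (norm_half_add_le a b) (by linarith : 0 ≤ p)
    have h2 := (strictConvexOn_rpow hp).2 (norm_nonneg a) (norm_nonneg b) h
      (by norm_num : (0 : ℝ) < 1 / 2) (by norm_num : (0 : ℝ) < 1 / 2) (by norm_num)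
    simp only [smul_eq_mul] at h2
    have h3 : 1 / 2 * ‖a‖ + 1 / 2 * ‖b‖ = (‖a‖ + ‖b‖) / 2 := by ring
    rw [h3] at h2
    linarith

/-- A form of uniform convexity of `‖·‖ ^ p`: up to a small multiple of `‖a‖ ^ p + ‖b‖ ^ p`, the
distance of `a` and `b` is controlled by the convexity gap. -/
theorem exists_norm_sub_rpow_le [FiniteDimensional ℝ H] {p : ℝ} (hp : 1 < p) {ε : ℝ}
    (hε : 0 < ε) : ∃ C : ℝ, 0 ≤ C ∧ ∀ a b : H,
      ‖a - b‖ ^ p ≤ ε * (‖a‖ ^ p + ‖b‖ ^ p) +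
        C * ((‖a‖ ^ p + ‖b‖ ^ p) / 2 - ‖(1 / 2 : ℝ) • (a + b)‖ ^ p) := by
  have hp0 : 0 < p := by linarith
  let gap : H × H → ℝ := fun z =>
    (‖z.1‖ ^ p + ‖z.2‖ ^ p) / 2 - ‖(1 / 2 : ℝ) • (z.1 + z.2)‖ ^ p
  have hcont : ∀ F : H × H → ℝ, Continuous F → Continuous fun z => F z ^ p := fun F hF =>
    hF.rpow_const fun _ => Or.inr hp0.le
  have hgap : Continuous gap :=
    (((hcont _ (continuous_norm.comp continuous_fst)).add
      (hcont _ (continuous_norm.comp continuous_snd))).div_const 2).sub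
      (hcont _ (by fun_prop))
  -- Both sides are homogeneous of degree `p`, so unit pairs suffice. Off `K` the `ε` term alone is
  -- enough; on the compact set `K` the gap has a positive minimum.
  let K : Set (H × H) := Metric.sphere 0 1 ∩
    {z | ε * (‖z.1‖ ^ p + ‖z.2‖ ^ p) ≤ ‖z.1 - z.2‖ ^ p}
  have hK : IsCompact K := (isCompact_sphere 0 1).inter_right <| isClosed_le
    (((hcont _ (continuous_norm.comp continuous_fst)).add
      (hcont _ (continuous_norm.comp continuous_snd))).const_mul ε |>.congr fun _ => rfl)
    (hcont (fun z : H × H => ‖z.1 - z.2‖) (by fun_prop))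
  have hgappos : ∀ z ∈ K, 0 < gap z := by
    rintro ⟨a, b⟩ ⟨hz, hle⟩
    have hne : a ≠ b := by
      rintro rfl
      simp only [Set.mem_ofPred_eq, sub_self, norm_zero, Real.zero_rpow hp0.ne'] at hle
      have hna : ‖a‖ = 1 := by simpa [Prod.norm_def] using hz
      rw [hna, Real.one_rpow] at hle
      linarith
    exact sub_pos.2 (norm_half_add_rpow_lt hp hne)
  have hunit : ∃ C : ℝ, 0 ≤ C ∧ ∀ z : H × H, ‖z‖ = 1 →
      ‖z.1 - z.2‖ ^ p ≤ ε * (‖z.1‖ ^ p + ‖z.2‖ ^ p) + C * gap z := by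
    have hgap0 : ∀ z, 0 ≤ gap z := fun z => sub_nonneg.2 (norm_half_add_rpow_le hp _ _)
    have hright : ∀ z : H × H, 0 ≤ ε * (‖z.1‖ ^ p + ‖z.2‖ ^ p) := fun z => by positivity
    rcases K.eq_empty_or_nonempty with hemp | hne
    · refine ⟨0, le_rfl, fun z hz => ?_⟩
      by_contra hcon
      have : z ∈ K := ⟨by simpa using hz, by
        simp only [Set.mem_ofPred_eq]; linarith⟩
      simp [hemp] at this
    · obtain ⟨z₀, hz₀, hmin⟩ := hK.exists_isMinOn hne hgap.continuousOn
      have hδ := hgappos z₀ hz₀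
      -- On the unit sphere `‖a - b‖ ≤ 2`, so this constant times the minimal gap already dominates
      -- `‖a - b‖ ^ p`.
      refine ⟨2 ^ p / gap z₀, by positivity, fun z hz => ?_⟩
      by_cases hzK : z ∈ K
      · have h1 : gap z₀ ≤ gap z := hmin hzK
        have h2 : ‖z.1 - z.2‖ ≤ 2 := by
          have := norm_sub_le z.1 z.2
          have := norm_fst_le z
          have := norm_snd_le z
          linarith
        have h3 := Real.rpow_le_rpow (norm_nonneg _) h2 hp0.le
        have h4 : (2 : ℝ) ^ p ≤ 2 ^ p / gap z₀ * gap z := by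
          rw [div_mul_eq_mul_div, le_div_iff₀ hδ]
          gcongr
        linarith [hright z]
      · have : ‖z.1 - z.2‖ ^ p < ε * (‖z.1‖ ^ p + ‖z.2‖ ^ p) := by
          by_contra hcon
          exact hzK ⟨by simpa using hz, not_lt.1 hcon⟩
        have h5 : 0 ≤ 2 ^ p / gap z₀ * gap z := mul_nonneg (by positivity) (hgap0 z)
        linarith
  obtain ⟨C, hC, hb⟩ := hunit
  refine ⟨C, hC, fun a b => ?_⟩
  by_cases h0 : ((a, b) : H × H) = 0
  · obtain ⟨rfl, rfl⟩ := Prod.mk_eq_zero.1 h0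
    simp [Real.zero_rpow hp0.ne']
  set r := ‖((a, b) : H × H)‖ with hr
  have hrpos : 0 < r := norm_pos_iff.2 h0
  have hz : ‖(r⁻¹ • ((a, b) : H × H))‖ = 1 := norm_smul_inv_norm (𝕜 := ℝ) h0
  have key := hb _ hz
  have hsc : ∀ c : H, ‖r⁻¹ • c‖ ^ p = (r⁻¹) ^ p * ‖c‖ ^ p := fun c => by
    rw [norm_smul, Real.norm_of_nonneg (by positivity), Real.mul_rpow (by positivity)
      (norm_nonneg _)]
  simp only [gap, Prod.smul_mk, ← smul_sub, ← smul_add, smul_comm (1 / 2 : ℝ) r⁻¹, hsc] at key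
  have hrp : 0 < (r⁻¹) ^ p := by positivity
  refine le_of_mul_le_mul_left ?_ hrp
  linarith

/-- The gradient inequality for the convex function `‖·‖ ^ p / p`. -/
theorem rpow_norm_gradient_le {p : ℝ} (hp : 1 < p) (a b : H) :
    ‖b‖ ^ p / p + ‖b‖ ^ (p - 2) * inner ℝ (a - b) b ≤ ‖a‖ ^ p / p := by
  have hp0 : 0 < p := by linarith
  rcases eq_or_ne b 0 with rfl | hb
  · simp only [norm_zero, Real.zero_rpow hp0.ne', inner_zero_right, mul_zero, zero_div, add_zero]
    positivity
  have hbn : 0 < ‖b‖ := norm_pos_iff.2 hb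
  have hq := Real.HolderConjugate.conjExponent hp
  have h1 := Real.young_inequality_of_nonneg (norm_nonneg a)
    (by positivity : 0 ≤ ‖b‖ ^ (p - 1)) hq
  rw [← Real.rpow_mul hbn.le, hq.sub_one_mul_conj] at h1
  have h2 : ‖b‖ ^ (p - 2) * inner ℝ a b ≤ ‖a‖ * ‖b‖ ^ (p - 1) := by
    calc ‖b‖ ^ (p - 2) * inner ℝ a b ≤ ‖b‖ ^ (p - 2) * (‖a‖ * ‖b‖) := by
          gcongr; exact real_inner_le_norm a b
      _ = ‖a‖ * (‖b‖ ^ (p - 2) * ‖b‖ ^ (1 : ℝ)) := by rw [Real.rpow_one]; ring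
      _ = ‖a‖ * ‖b‖ ^ (p - 1) := by rw [← Real.rpow_add hbn]; ring_nf
  have h3 : ‖b‖ ^ (p - 2) * inner ℝ b b = ‖b‖ ^ p := by
    rw [real_inner_self_eq_norm_sq, ← Real.rpow_natCast, ← Real.rpow_add hbn]; norm_num
  have h4 : ‖b‖ ^ p / p + ‖b‖ ^ p / p.conjExponent = ‖b‖ ^ p := by
    have := hq.inv_add_inv_eq_one
    rw [div_eq_mul_inv, div_eq_mul_inv, ← mul_add, this, mul_one]
  rw [inner_sub_left, mul_sub, h3]
  linarith

theorem abs_rpow_mul_inner_le {p : ℝ} (hp : 1 < p) (a b : H) :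
    |‖b‖ ^ (p - 2) * inner ℝ a b| ≤ ‖b‖ ^ (p - 1) * ‖a‖ := by
  rcases eq_or_ne b 0 with rfl | hb
  · simp [Real.zero_rpow (by linarith : p - 1 ≠ 0)]
  have hbn : 0 < ‖b‖ := norm_pos_iff.2 hb
  rw [abs_mul, abs_of_nonneg (by positivity)]
  calc ‖b‖ ^ (p - 2) * |inner ℝ a b| ≤ ‖b‖ ^ (p - 2) * (‖a‖ * ‖b‖) := by
        gcongr; exact abs_real_inner_le_norm a b
    _ = (‖b‖ ^ (p - 2) * ‖b‖ ^ (1 : ℝ)) * ‖a‖ := by rw [Real.rpow_one]; ring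
    _ = _ := by rw [← Real.rpow_add hbn]; ring_nf

theorem abs_rpow_mul_inner_le_add_rpow {p : ℝ} (hp : 1 < p) (a b : H) {s : ℝ}
    (ha : ‖a‖ ≤ s) (hb : ‖b‖ ≤ s) :
    |‖b‖ ^ (p - 2) * inner ℝ a b| ≤ s ^ p := by
  refine (abs_rpow_mul_inner_le hp a b).trans ?_
  have hs : 0 ≤ s := (norm_nonneg a).trans ha
  calc ‖b‖ ^ (p - 1) * ‖a‖ ≤ s ^ (p - 1) * s :=
        mul_le_mul (Real.rpow_le_rpow (norm_nonneg _) hb (by linarith)) ha (norm_nonneg _)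
          (by positivity)
    _ = s ^ p := by
        rcases hs.eq_or_lt with rfl | hs
        · simp [Real.zero_rpow (by linarith : p ≠ 0)]
        · rw [← Real.rpow_add_one hs.ne']; ring_nf

/-- The factor `‖b‖ ^ (p - 2)` may blow up at `0` when `p < 2`, but the product is at most `‖b‖ ^ (p
- 1) * ‖a‖` in absolute value. -/
theorem continuous_rpow_mul_inner {p : ℝ} (hp : 1 < p) (a : H) :
    Continuous fun b : H => ‖b‖ ^ (p - 2) * inner ℝ a b := by
  refine continuous_iff_continuousAt.2 fun b => ?_
  rcases eq_or_ne b 0 with rfl | hb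
  · have h : Tendsto (fun b : H => ‖b‖ ^ (p - 1) * ‖a‖) (𝓝 0) (𝓝 0) := by
      have : Continuous fun b : H => ‖b‖ ^ (p - 1) * ‖a‖ :=
        (continuous_norm.rpow_const fun _ => Or.inr (by linarith)).mul_const _
      have h := this.tendsto 0
      simpa [Real.zero_rpow (by linarith : p - 1 ≠ 0)] using h
    unfold ContinuousAt
    simp only [inner_zero_right, mul_zero]
    exact squeeze_zero_norm (fun b => abs_rpow_mul_inner_le hp a b) h
  · exact (continuous_norm.continuousAt.rpow_const (Or.inl (norm_ne_zero_iff.2 hb))).mul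
      (by fun_prop)

end Pointwise

/-! ### The estimates integrated over `L^p`, and the direct method. -/

section Variational

variable {α : Type*} [MeasurableSpace α] {ν : Measure α} {p : ℝ}

section Norm

variable {H : Type*} [NormedAddCommGroup H]

theorem integrable_norm_rpow_of_memLp (hp : 1 < p) {f : α → H}
    (hf : MemLp f (ENNReal.ofReal p) ν) : Integrable (fun x => ‖f x‖ ^ p) ν := by
  have h := hf.integrable_norm_rpow (by simpa using by linarith) ENNReal.ofReal_ne_top
  rwa [ENNReal.toReal_ofReal (by linarith)] at h

theorem Lp_norm_rpow (hp : 1 < p) (f : Lp H (ENNReal.ofReal p) ν) :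
    ‖f‖ ^ p = ∫ x, ‖f x‖ ^ p ∂ν := by
  have hp0 : 0 < p := by linarith
  have hnn : 0 ≤ ∫ x, ‖f x‖ ^ p ∂ν := integral_nonneg fun x => by positivity
  rw [Lp.norm_def, (Lp.memLp f).eLpNorm_eq_integral_rpow_norm (by simpa using hp0)
    ENNReal.ofReal_ne_top, ENNReal.toReal_ofReal hp0.le,
    ENNReal.toReal_ofReal (by positivity), Real.rpow_inv_rpow hnn hp0.ne']

theorem integrable_add_norm_rpow (hp : 1 < p) {w b : α → H}
    (hw : MemLp w (ENNReal.ofReal p) ν) (hb : MemLp b (ENNReal.ofReal p) ν) :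
    Integrable (fun x => (‖b x‖ + ‖w x‖) ^ p) ν := by
  have h := integrable_norm_rpow_of_memLp hp (hb.norm.add hw.norm)
  refine h.congr (Eventually.of_forall fun x => ?_)
  simp only [Pi.add_apply]
  rw [Real.norm_of_nonneg (by positivity)]

end Norm

variable {H : Type*} [NormedAddCommGroup H] [InnerProductSpace ℝ H]

/-- The pointwise constant does not depend on the vectors, so the inequality integrates. It serves
as the uniform convexity of `L^p`. -/
theorem exists_Lp_norm_sub_rpow_le [FiniteDimensional ℝ H] (hp : 1 < p) {ε : ℝ} (hε : 0 < ε) :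
    ∃ C : ℝ, 0 ≤ C ∧ ∀ f g : Lp H (ENNReal.ofReal p) ν,
      ‖f - g‖ ^ p ≤ ε * (‖f‖ ^ p + ‖g‖ ^ p) +
        C * ((‖f‖ ^ p + ‖g‖ ^ p) / 2 - ‖(1 / 2 : ℝ) • (f + g)‖ ^ p) := by
  obtain ⟨C, hC, h⟩ := exists_norm_sub_rpow_le (H := H) hp hε
  refine ⟨C, hC, fun f g => ?_⟩
  have hi : ∀ f : Lp H (ENNReal.ofReal p) ν, Integrable (fun x => ‖f x‖ ^ p) ν := fun f =>
    integrable_norm_rpow_of_memLp hp (Lp.memLp f)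
  simp only [Lp_norm_rpow hp]
  have h1 : Integrable (fun x => ε * (‖f x‖ ^ p + ‖g x‖ ^ p)) ν :=
    ((hi f).add (hi g)).const_mul ε
  have h2 : Integrable (fun x => (‖f x‖ ^ p + ‖g x‖ ^ p) / 2) ν := ((hi f).add (hi g)).div_const 2
  have h3 : Integrable (fun x => C * ((‖f x‖ ^ p + ‖g x‖ ^ p) / 2 -
      ‖((1 / 2 : ℝ) • (f + g) : Lp H (ENNReal.ofReal p) ν) x‖ ^ p)) ν :=
    (h2.sub (hi _)).const_mul C
  rw [← integral_add (hi f) (hi g), ← integral_div, ← integral_sub h2 (hi _),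
    ← integral_const_mul, ← integral_const_mul, ← integral_add h1 h3]
  refine integral_mono_ae (hi _) (h1.add h3) ?_
  filter_upwards [Lp.coeFn_sub f g, Lp.coeFn_smul (1 / 2 : ℝ) (f + g), Lp.coeFn_add f g]
    with x h1 h2 h3
  have := h (f x) (g x)
  simp only [h1, h2, h3, Pi.smul_apply, Pi.add_apply, Pi.sub_apply]
  exact this

theorem aestronglyMeasurable_rpow_mul_inner {w b : α → H} (hw : AEStronglyMeasurable w ν)
    (hb : AEStronglyMeasurable b ν) :
    AEStronglyMeasurable (fun x => ‖b x‖ ^ (p - 2) * inner ℝ (w x) (b x)) ν :=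
  (hb.norm.aemeasurable.pow_const _).aestronglyMeasurable.mul (hw.inner hb)

theorem integrable_rpow_mul_inner (hp : 1 < p) {w b : α → H}
    (hw : MemLp w (ENNReal.ofReal p) ν) (hb : MemLp b (ENNReal.ofReal p) ν) :
    Integrable (fun x => ‖b x‖ ^ (p - 2) * inner ℝ (w x) (b x)) ν := by
  refine (integrable_add_norm_rpow hp hw hb).mono'
    (aestronglyMeasurable_rpow_mul_inner hw.1 hb.1) (Eventually.of_forall fun x => ?_)
  exact abs_rpow_mul_inner_le_add_rpow hp _ _ (le_add_of_nonneg_left (norm_nonneg _))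
    (le_add_of_nonneg_right (norm_nonneg _))

theorem Lp_norm_rpow_gradient_le (hp : 1 < p) (a b : Lp H (ENNReal.ofReal p) ν) :
    ‖b‖ ^ p / p + ∫ x, ‖b x‖ ^ (p - 2) * inner ℝ ((a - b) x) (b x) ∂ν ≤ ‖a‖ ^ p / p := by
  have hi : ∀ f : Lp H (ENNReal.ofReal p) ν, Integrable (fun x => ‖f x‖ ^ p / p) ν := fun f =>
    (integrable_norm_rpow_of_memLp hp (Lp.memLp f)).div_const p
  have hj := integrable_rpow_mul_inner hp (Lp.memLp (a - b)) (Lp.memLp b)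
  rw [Lp_norm_rpow hp, Lp_norm_rpow hp, ← integral_div, ← integral_div, ← integral_add (hi b) hj]
  refine integral_mono_ae ((hi b).add hj) (hi a) ?_
  filter_upwards [Lp.coeFn_sub a b] with x hx
  simp only [hx, Pi.sub_apply]
  exact rpow_norm_gradient_le hp (a x) (b x)

theorem tendsto_integral_rpow_mul_inner (hp : 1 < p) (w b : Lp H (ENNReal.ofReal p) ν)
    {t : ℕ → ℝ} (ht : Tendsto t atTop (𝓝 0)) (ht1 : ∀ k, |t k| ≤ 1) :
    Tendsto (fun k => ∫ x, ‖(b + t k • w) x‖ ^ (p - 2) * inner ℝ (w x) ((b + t k • w) x) ∂ν)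
      atTop (𝓝 (∫ x, ‖b x‖ ^ (p - 2) * inner ℝ (w x) (b x) ∂ν)) := by
  have hcoe : ∀ᵐ x ∂ν, ∀ k, (b + t k • w) x = b x + t k • w x := by
    refine ae_all_iff.2 fun k => ?_
    filter_upwards [Lp.coeFn_add b (t k • w), Lp.coeFn_smul (t k) w] with x h1 h2
    rw [h1, Pi.add_apply, h2, Pi.smul_apply]
  refine tendsto_integral_filter_of_dominated_convergence (fun x => (‖b x‖ + ‖w x‖) ^ p)
    (Eventually.of_forall fun k => aestronglyMeasurable_rpow_mul_inner
      (Lp.aestronglyMeasurable w) (Lp.aestronglyMeasurable _))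
    (Eventually.of_forall fun k => ?_)
    (integrable_add_norm_rpow hp (Lp.memLp w) (Lp.memLp b)) ?_
  · filter_upwards [hcoe] with x hx
    refine abs_rpow_mul_inner_le_add_rpow hp _ _ (le_add_of_nonneg_left (norm_nonneg _)) ?_
    rw [hx k]
    refine (norm_add_le _ _).trans (add_le_add_right ?_ _)
    rw [norm_smul]
    exact mul_le_of_le_one_left (norm_nonneg _) (ht1 k)
  · filter_upwards [hcoe] with x hx
    simp only [hx]
    have h : Tendsto (fun k => b x + t k • w x) atTop (𝓝 (b x)) := by
      simpa using (ht.smul_const (w x)).const_add (b x)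
    exact ((continuous_rpow_mul_inner hp (w x)).tendsto (b x)).comp h

variable {V : Type*} [AddCommGroup V] [Module ℝ V]

/-- If `‖h‖ ^ p / p ≤ ‖h + t • w‖ ^ p / p + t * c` for all small `t > 0`, then the one-sided
derivative of the right-hand side is nonnegative. -/
theorem integral_rpow_mul_inner_add_nonneg (hp : 1 < p) (h w : Lp H (ENNReal.ofReal p) ν) (c : ℝ)
    (hmin : ∀ t : ℝ, ‖h‖ ^ p / p ≤ ‖h + t • w‖ ^ p / p + t * c) :
    0 ≤ (∫ x, ‖h x‖ ^ (p - 2) * inner ℝ (w x) (h x) ∂ν) + c := by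
  let t : ℕ → ℝ := fun k => 1 / ((k : ℝ) + 1)
  have htpos : ∀ k, 0 < t k := fun k => by positivity
  have ht1 : ∀ k, |t k| ≤ 1 := fun k => by
    rw [abs_of_pos (htpos k)]
    exact div_le_one_of_le₀ (by linarith [(k.cast_nonneg : (0 : ℝ) ≤ k)]) (by positivity)
  have hlim := (tendsto_integral_rpow_mul_inner hp w h
    (tendsto_one_div_add_atTop_nhds_zero_nat (𝕜 := ℝ)) ht1).add_const c
  refine ge_of_tendsto' hlim fun k => ?_
  -- The gradient inequality based at the perturbed point bounds the difference quotient by the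
  -- derivative there, so only continuity of the derivative in `t` is needed.
  have h1 := Lp_norm_rpow_gradient_le hp h (h + t k • w)
  have h2 : ∫ x, ‖(h + t k • w) x‖ ^ (p - 2) *
      inner ℝ ((h - (h + t k • w)) x) ((h + t k • w) x) ∂ν =
      -(t k) * ∫ x, ‖(h + t k • w) x‖ ^ (p - 2) * inner ℝ (w x) ((h + t k • w) x) ∂ν := by
    rw [← integral_const_mul]
    refine integral_congr_ae ?_
    have h3 : h - (h + t k • w) = (-(t k)) • w := by module
    rw [h3]
    filter_upwards [Lp.coeFn_smul (-(t k)) w] with x hx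
    rw [hx, Pi.smul_apply, real_inner_smul_left]
    ring
  rw [h2] at h1
  have h4 := hmin (t k)
  have h5 : 0 ≤ t k * ((∫ x, ‖(h + t k • w) x‖ ^ (p - 2) *
      inner ℝ (w x) ((h + t k • w) x) ∂ν) + c) := by linarith
  exact nonneg_of_mul_nonneg_right h5 (htpos k)

/-- The direct method: for a linear map `T` into `Lp` and a linear functional `ℓ` bounded with
respect to `‖T x‖`, the functional `‖T x‖ ^ p / p + ℓ x` has a minimizing sequence along which
`T x` converges, and the limit satisfies the Euler–Lagrange equation. -/
theorem exists_tendsto_eulerLagrange [FiniteDimensional ℝ H] [Fact (1 ≤ ENNReal.ofReal p)] (hp : 1 < p)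
    (T : V →ₗ[ℝ] Lp H (ENNReal.ofReal p) ν) (ℓ : V →ₗ[ℝ] ℝ) (K : ℝ)
    (hK : ∀ x, |ℓ x| ≤ K * ‖T x‖) :
    ∃ (x : ℕ → V) (h : Lp H (ENNReal.ofReal p) ν),
      Tendsto (fun k => T (x k)) atTop (𝓝 h) ∧
      ∀ y, ∫ z, ‖h z‖ ^ (p - 2) * inner ℝ (T y z) (h z) ∂ν = -ℓ y := by
  have hp0 : 0 < p := by linarith
  let J : V → ℝ := fun x => ‖T x‖ ^ p / p + ℓ x
  obtain ⟨B, hB⟩ : ∃ B : ℝ, ∀ x, ‖T x‖ ^ p / (2 * p) - B ≤ J x := by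
    -- Young's inequality for `(‖T x‖ / 2) * (2 * |K|)`: the halving leaves half of the energy after
    -- the linear term is absorbed.
    refine ⟨(2 * |K|) ^ p.conjExponent / p.conjExponent, fun x => ?_⟩
    have h1 := Real.young_inequality_of_nonneg (by positivity : 0 ≤ ‖T x‖ / 2)
      (by positivity : 0 ≤ 2 * |K|) (Real.HolderConjugate.conjExponent hp)
    have h2 : (‖T x‖ / 2) ^ p ≤ ‖T x‖ ^ p / 2 := by
      rw [Real.div_rpow (norm_nonneg _) (by norm_num)]
      gcongr
      simpa using Real.rpow_le_rpow_of_exponent_le (by norm_num : (1 : ℝ) ≤ 2) hp.le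
    have h3 : (‖T x‖ / 2) ^ p / p ≤ ‖T x‖ ^ p / 2 / p := by gcongr
    have h4 : ‖T x‖ ^ p / 2 / p = ‖T x‖ ^ p / (2 * p) := by rw [div_div]
    have h5 : ‖T x‖ ^ p / p = 2 * (‖T x‖ ^ p / (2 * p)) := by field_simp
    have h6 : K * ‖T x‖ ≤ |K| * ‖T x‖ := by gcongr; exact le_abs_self K
    have h7 := (abs_le.1 (hK x)).1
    simp only [J]
    linarith
  have hbdd : BddBelow (Set.range J) := by
    refine ⟨-B, ?_⟩
    rintro _ ⟨x, rfl⟩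
    have : 0 ≤ ‖T x‖ ^ p / (2 * p) := by positivity
    linarith [hB x]
  set m := ⨅ x, J x with hm
  have hmJ : ∀ x, m ≤ J x := fun x => ciInf_le hbdd x
  have hex : ∀ k : ℕ, ∃ x, J x < m + 1 / ((k : ℝ) + 1) := fun k =>
    exists_lt_of_ciInf_lt (lt_add_of_pos_right _ (by positivity))
  choose x hx using hex
  let M : ℝ := 2 * p * (m + 1 + B)
  have hM : ∀ k, ‖T (x k)‖ ^ p ≤ M := fun k => by
    have h1 := hB (x k)
    have h2 := hx k
    have h3 : 1 / ((k : ℝ) + 1) ≤ 1 :=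
      div_le_one_of_le₀ (by linarith [(k.cast_nonneg : (0 : ℝ) ≤ k)]) (by positivity)
    have h4 : ‖T (x k)‖ ^ p / (2 * p) ≤ m + 1 + B := by linarith
    rw [div_le_iff₀ (by positivity)] at h4
    simp only [M]
    linarith
  have hM0 : 0 ≤ M := le_trans (by positivity) (hM 0)
  have hcauchy : CauchySeq fun k => T (x k) := by
    refine Metric.cauchySeq_iff.2 fun δ hδ => ?_
    have hδp : 0 < δ ^ p := by positivity
    -- `ε` and `N` are chosen so that the `ε` term and the gap term each contribute at most `δ ^ p /
    -- 2`.
    obtain ⟨C, hC, hCb⟩ := exists_Lp_norm_sub_rpow_le (H := H) (ν := ν) hp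
      (show 0 < δ ^ p / (4 * (M + 1)) by positivity)
    obtain ⟨N, hN⟩ := exists_nat_one_div_lt (show 0 < δ ^ p / (2 * (C * p + 1)) by positivity)
    refine ⟨N, fun k hk l hl => ?_⟩
    have hs : ∀ k ≥ N, J (x k) < m + 1 / ((N : ℝ) + 1) := fun k hk =>
      (hx k).trans_le (by gcongr)
    have h1 := hCb (T (x k)) (T (x l))
    have h2 := hmJ ((1 / 2 : ℝ) • (x k + x l))
    -- The linear part of `J` cancels in the midpoint gap, and the gap of `J` is small because the
    -- midpoint value is at least `m`.
    have h3 : (‖T (x k)‖ ^ p + ‖T (x l)‖ ^ p) / 2 - ‖(1 / 2 : ℝ) • (T (x k) + T (x l))‖ ^ p =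
        p * ((J (x k) + J (x l)) / 2 - J ((1 / 2 : ℝ) • (x k + x l))) := by
      simp only [J, map_smul, map_add, smul_eq_mul]
      field_simp
      ring
    have h4 : (J (x k) + J (x l)) / 2 - J ((1 / 2 : ℝ) • (x k + x l)) ≤ 1 / ((N : ℝ) + 1) := by
      linarith [hs k hk, hs l hl]
    have h5 : δ ^ p / (4 * (M + 1)) * (‖T (x k)‖ ^ p + ‖T (x l)‖ ^ p) < δ ^ p / 2 := by
      have h6 : ‖T (x k)‖ ^ p + ‖T (x l)‖ ^ p < 2 * (M + 1) := by linarith [hM k, hM l]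
      calc _ < δ ^ p / (4 * (M + 1)) * (2 * (M + 1)) := by gcongr
        _ = δ ^ p / 2 := by field_simp; norm_num
    have h7 : C * (p * ((J (x k) + J (x l)) / 2 - J ((1 / 2 : ℝ) • (x k + x l)))) ≤ δ ^ p / 2 := by
      have h8 : C * p * (δ ^ p / (2 * (C * p + 1))) ≤ δ ^ p / 2 := by
        rw [mul_div_assoc', div_le_div_iff₀ (by positivity) (by norm_num)]
        nlinarith
      calc _ = C * p * ((J (x k) + J (x l)) / 2 - J ((1 / 2 : ℝ) • (x k + x l))) := by ring
        _ ≤ C * p * (δ ^ p / (2 * (C * p + 1))) := by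
          gcongr
          exact h4.trans hN.le
        _ ≤ _ := h8
    rw [h3] at h1
    rw [dist_eq_norm]
    exact (Real.rpow_lt_rpow_iff (norm_nonneg _) hδ.le hp0).1 (by linarith)
  obtain ⟨h, hh⟩ := cauchySeq_tendsto_of_complete hcauchy
  have hnorm : ∀ {f : ℕ → Lp H (ENNReal.ofReal p) ν} {g}, Tendsto f atTop (𝓝 g) →
      Tendsto (fun k => ‖f k‖ ^ p / p) atTop (𝓝 (‖g‖ ^ p / p)) := fun hf =>
    (hf.norm.rpow_const (Or.inr hp0.le)).div_const p
  have hJ : Tendsto (fun k => J (x k)) atTop (𝓝 m) := by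
    have h1 := (tendsto_one_div_add_atTop_nhds_zero_nat (𝕜 := ℝ)).const_add m
    rw [add_zero] at h1
    exact tendsto_of_tendsto_of_tendsto_of_le_of_le tendsto_const_nhds h1
      (fun k => hmJ _) fun k => (hx k).le
  -- `h` need not be in the range of `T`, so `ℓ` has no value at it; `m - ‖h‖ ^ p / p`, the limit of
  -- `ℓ (x k)`, takes its place.
  have hmin : ∀ (y : V) (t : ℝ), ‖h‖ ^ p / p ≤ ‖h + t • T y‖ ^ p / p + t * ℓ y := by
    intro y t
    have h1 := (hnorm (hh.add_const (t • T y))).add ((hJ.sub (hnorm hh)).add_const (t * ℓ y))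
    have h2 : m ≤ ‖h + t • T y‖ ^ p / p + (m - ‖h‖ ^ p / p + t * ℓ y) := by
      refine ge_of_tendsto' h1 fun k => ?_
      have h3 := hmJ (x k + t • y)
      simp only [J, map_add, map_smul, smul_eq_mul] at h3 ⊢
      linarith
    linarith
  refine ⟨x, h, hh, fun y => le_antisymm ?_ ?_⟩
  · have h1 := integral_rpow_mul_inner_add_nonneg hp h (T (-y)) (ℓ (-y)) (hmin (-y))
    have h2 : ∫ z, ‖h z‖ ^ (p - 2) * inner ℝ (T (-y) z) (h z) ∂ν =
        -∫ z, ‖h z‖ ^ (p - 2) * inner ℝ (T y z) (h z) ∂ν := by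
      rw [← integral_neg, map_neg]
      refine integral_congr_ae ?_
      filter_upwards [Lp.coeFn_neg (T y)] with z hz
      rw [hz, Pi.neg_apply, inner_neg_left, mul_neg]
    rw [h2, map_neg] at h1
    linarith
  · linarith [integral_rpow_mul_inner_add_nonneg hp h (T y) (ℓ y) (hmin y)]

end Variational

/-! ### Measurable square root and pseudoinverse by functional calculus. -/

section Matrices

variable {n : ℕ}

theorem cfc_apply_eq_sum {A : Matrix (Fin n) (Fin n) ℝ} (hA : A.IsHermitian) (f : ℝ → ℝ)
    (i j : Fin n) : cfc f A i j = ∑ k, (hA.eigenvectorUnitary : Matrix (Fin n) (Fin n) ℝ) i k *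
      f (hA.eigenvalues k) * (hA.eigenvectorUnitary : Matrix (Fin n) (Fin n) ℝ) j k := by
  rw [hA.cfc_eq, Matrix.IsHermitian.cfc, Unitary.conjStarAlgAut_apply, Matrix.mul_apply]
  refine Finset.sum_congr rfl fun k _ => ?_
  rw [Matrix.mul_diagonal]
  simp [Matrix.star_apply]

/-- The spectrum is finite, so pointwise convergence suffices and the limit function may be
discontinuous. -/
theorem tendsto_cfc_apply {A : Matrix (Fin n) (Fin n) ℝ} (hA : A.IsHermitian)
    {F : ℕ → ℝ → ℝ} {f : ℝ → ℝ} (h : ∀ x, Tendsto (fun m => F m x) atTop (𝓝 (f x)))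
    (i j : Fin n) : Tendsto (fun m => cfc (F m) A i j) atTop (𝓝 (cfc f A i j)) := by
  simp only [cfc_apply_eq_sum hA]
  exact tendsto_finsetSum _ fun k _ => ((h _).const_mul _).mul_const _

theorem continuousOn_spectrum (A : Matrix (Fin n) (Fin n) ℝ) (f : ℝ → ℝ) :
    ContinuousOn f (spectrum ℝ A) :=
  (Matrix.finite_real_spectrum (A := A)).continuousOn f

variable {α : Type*} [MeasurableSpace α] {ν : Measure α} {A : α → Matrix (Fin n) (Fin n) ℝ}

theorem aemeasurable_pow_apply (hm : ∀ i j, AEMeasurable (fun x => A x i j) ν) (k : ℕ) :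
    ∀ i j, AEMeasurable (fun x => (A x ^ k) i j) ν := by
  induction k with
  | zero => intro i j; simp
  | succ k ih =>
    intro i j
    simp only [pow_succ, Matrix.mul_apply]
    exact Finset.aemeasurable_fun_sum _ fun l _ => (ih i l).mul (hm l j)

theorem aemeasurable_cfc_polynomial (hm : ∀ i j, AEMeasurable (fun x => A x i j) ν)
    (hA : ∀ᵐ x ∂ν, (A x).IsHermitian) (q : Polynomial ℝ) (i j : Fin n) :
    AEMeasurable (fun x => cfc (fun t => q.eval t) (A x) i j) ν := by
  have h : AEMeasurable
      (fun x => ∑ k ∈ Finset.range (q.natDegree + 1), q.coeff k * (A x ^ k) i j) ν :=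
    Finset.aemeasurable_fun_sum _ fun k _ => (aemeasurable_pow_apply hm k i j).const_mul _
  refine h.congr ?_
  filter_upwards [hA] with x hx
  rw [cfc_polynomial q (A x) hx.isSelfAdjoint, Polynomial.aeval_eq_sum_range, Matrix.sum_apply]
  simp

theorem aemeasurable_cfc_of_tendsto (hA : ∀ᵐ x ∂ν, (A x).IsHermitian)
    {F : ℕ → ℝ → ℝ} {f : ℝ → ℝ} (h : ∀ x, Tendsto (fun m => F m x) atTop (𝓝 (f x)))
    (hF : ∀ m i j, AEMeasurable (fun x => cfc (F m) (A x) i j) ν) (i j : Fin n) :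
    AEMeasurable (fun x => cfc f (A x) i j) ν := by
  refine aemeasurable_of_tendsto_metrizable_ae atTop (fun m => hF m i j) ?_
  filter_upwards [hA] with x hx
  exact tendsto_cfc_apply hx h i j

/-- Weierstrass approximation on the growing intervals `[-m, m]` reduces to polynomials, whose
entries are polynomial in those of `A`. No measurable choice of eigenvectors is involved. -/
theorem aemeasurable_cfc_of_continuous (hm : ∀ i j, AEMeasurable (fun x => A x i j) ν)
    (hA : ∀ᵐ x ∂ν, (A x).IsHermitian) {f : ℝ → ℝ} (hf : Continuous f) (i j : Fin n) :
    AEMeasurable (fun x => cfc f (A x) i j) ν := by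
  have h : ∀ m : ℕ, ∃ q : Polynomial ℝ, ∀ x ∈ Set.Icc (-(m : ℝ)) m,
      |q.eval x - f x| < 1 / ((m : ℝ) + 1) := fun m =>
    exists_polynomial_near_of_continuousOn _ _ f hf.continuousOn _ (by positivity)
  choose q hq using h
  refine aemeasurable_cfc_of_tendsto hA (F := fun m t => (q m).eval t) (fun x => ?_)
    (fun m => aemeasurable_cfc_polynomial hm hA (q m)) i j
  rw [tendsto_iff_norm_sub_tendsto_zero]
  refine squeeze_zero' (Eventually.of_forall fun _ => norm_nonneg _) ?_
    (tendsto_one_div_add_atTop_nhds_zero_nat (𝕜 := ℝ))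
  filter_upwards [eventually_ge_atTop ⌈|x|⌉₊] with m hm
  have hx : |x| ≤ m := (Nat.le_ceil _).trans (by exact_mod_cast hm)
  exact (hq m x (abs_le.1 hx)).le

/-- The positive semidefinite square root of a positive semidefinite matrix. -/
def rootMatrix (A : Matrix (Fin n) (Fin n) ℝ) : Matrix (Fin n) (Fin n) ℝ := cfc Real.sqrt A

/-- The pseudoinverse of `rootMatrix A`. -/
def rootPinv (A : Matrix (Fin n) (Fin n) ℝ) : Matrix (Fin n) (Fin n) ℝ :=
  cfc (fun t => (√t)⁻¹) A

theorem aemeasurable_rootMatrix (hm : ∀ i j, AEMeasurable (fun x => A x i j) ν)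
    (hA : ∀ᵐ x ∂ν, (A x).IsHermitian) (i j : Fin n) :
    AEMeasurable (fun x => rootMatrix (A x) i j) ν :=
  aemeasurable_cfc_of_continuous hm hA Real.continuous_sqrt i j

theorem aemeasurable_rootPinv (hm : ∀ i j, AEMeasurable (fun x => A x i j) ν)
    (hA : ∀ᵐ x ∂ν, (A x).IsHermitian) (i j : Fin n) :
    AEMeasurable (fun x => rootPinv (A x) i j) ν := by
  -- Continuous regularizations of `(√t)⁻¹`; where `√t = 0` they vanish, matching the convention
  -- `0⁻¹ = 0`.
  refine aemeasurable_cfc_of_tendsto hA (F := fun m t => √t / (√t * √t + 1 / ((m : ℝ) + 1)))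
    (fun x => ?_) (fun m => aemeasurable_cfc_of_continuous hm hA ?_) i j
  · rcases eq_or_ne (√x) 0 with h | h
    · simp [h]
    · have h1 := (tendsto_one_div_add_atTop_nhds_zero_nat (𝕜 := ℝ)).const_add (√x * √x)
      have h2 := (tendsto_const_nhds (x := √x)).div h1 (by simpa using h)
      have h3 : √x / (√x * √x + 0) = (√x)⁻¹ := by field_simp; simp
      rwa [h3] at h2
  · refine Real.continuous_sqrt.div (by fun_prop) fun t => ?_
    positivity

theorem rootMatrix_mul_self {A : Matrix (Fin n) (Fin n) ℝ} (hA : A.PosSemidef) :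
    rootMatrix A * rootMatrix A = A := by
  have hH := hA.isHermitian
  rw [rootMatrix, ← cfc_mul _ _ A (continuousOn_spectrum A _) (continuousOn_spectrum A _)]
  conv_rhs => rw [← cfc_id ℝ A hH.isSelfAdjoint]
  refine cfc_congr fun t ht => ?_
  have : 0 ≤ t := by
    rw [hH.spectrum_real_eq_range_eigenvalues] at ht
    obtain ⟨k, rfl⟩ := ht
    exact hA.eigenvalues_nonneg k
  simp [Real.mul_self_sqrt this]

theorem rootMatrix_mul_rootPinv_mul (A : Matrix (Fin n) (Fin n) ℝ) :
    rootMatrix A * rootPinv A * rootMatrix A = rootMatrix A := by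
  rw [rootMatrix, rootPinv, ← cfc_mul _ _ A (continuousOn_spectrum A _) (continuousOn_spectrum A _),
    ← cfc_mul _ _ A (continuousOn_spectrum A _) (continuousOn_spectrum A _)]
  exact cfc_congr fun t _ => mul_inv_mul_cancel _

theorem rootMatrix_isSymm (A : Matrix (Fin n) (Fin n) ℝ) : (rootMatrix A).IsSymm := by
  have : IsSelfAdjoint (rootMatrix A) := cfc_predicate _ _
  have h := this.star_eq
  rwa [Matrix.star_eq_conjTranspose, Matrix.conjTranspose_eq_transpose_of_trivial] at h

/-- The action of a matrix on Euclidean space. -/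
def act (A : Matrix (Fin n) (Fin n) ℝ) (ξ : EuclideanSpace ℝ (Fin n)) :
    EuclideanSpace ℝ (Fin n) := WithLp.toLp 2 (A.mulVec ξ.ofLp)

theorem act_add (A : Matrix (Fin n) (Fin n) ℝ) (ξ η : EuclideanSpace ℝ (Fin n)) :
    act A (ξ + η) = act A ξ + act A η := by
  simp [act, Matrix.mulVec_add]

theorem act_sub (A : Matrix (Fin n) (Fin n) ℝ) (ξ η : EuclideanSpace ℝ (Fin n)) :
    act A (ξ - η) = act A ξ - act A η := by
  simp [act, Matrix.mulVec_sub]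

theorem act_smul (A : Matrix (Fin n) (Fin n) ℝ) (c : ℝ) (ξ : EuclideanSpace ℝ (Fin n)) :
    act A (c • ξ) = c • act A ξ := by
  simp [act, Matrix.mulVec_smul]

theorem act_act (A B : Matrix (Fin n) (Fin n) ℝ) (ξ : EuclideanSpace ℝ (Fin n)) :
    act A (act B ξ) = act (A * B) ξ := by
  simp [act]

theorem continuous_act (A : Matrix (Fin n) (Fin n) ℝ) : Continuous (act A) := by
  unfold act
  fun_prop

theorem aemeasurable_act (hm : ∀ i j, AEMeasurable (fun x => A x i j) ν)
    {g : α → EuclideanSpace ℝ (Fin n)} (hg : AEMeasurable g ν) :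
    AEMeasurable (fun x => act (A x) (g x)) ν := by
  refine (WithLp.measurable_toLp 2 _).comp_aemeasurable (aemeasurable_pi_lambda _ fun i => ?_)
  simp only [Matrix.mulVec, dotProduct]
  refine Finset.aemeasurable_fun_sum _ fun j _ => (hm i j).mul ?_
  exact (measurable_pi_apply j).comp_aemeasurable
    ((WithLp.measurable_ofLp 2 _).comp_aemeasurable hg)

theorem sqrtNorm_eq_norm_act {A : Matrix (Fin n) (Fin n) ℝ} (hA : A.PosSemidef)
    (ξ : EuclideanSpace ℝ (Fin n)) : sqrtNorm A ξ = ‖act (rootMatrix A) ξ‖ :=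
  sqrtNorm_eq A _ (rootMatrix_isSymm A) (rootMatrix_mul_self hA) ξ

theorem bilin_eq_inner_act {A : Matrix (Fin n) (Fin n) ℝ} (hA : A.PosSemidef)
    (η ξ : EuclideanSpace ℝ (Fin n)) :
    bilin A η ξ = inner ℝ (act (rootMatrix A) η) (act (rootMatrix A) ξ) := by
  rw [bilin]
  conv_lhs => rw [← rootMatrix_mul_self hA]
  rw [← Matrix.mulVec_mulVec, Matrix.dotProduct_mulVec, ← Matrix.mulVec_transpose,
    (rootMatrix_isSymm A).eq]
  simp [act, EuclideanSpace.inner_eq_star_dotProduct, dotProduct_comm]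

end Matrices

/-! ### Linear maps into `Lp` from representatives. -/

section LinearMaps

/-- A family of functions in `L^p` that depends linearly, up to null sets, on `φ`, is a linear
map into `Lp`. -/
theorem exists_linearMap_coeFn_eq {W : Type*} [AddCommGroup W] [Module ℝ W] (V : Submodule ℝ W)
    {H : Type*} [NormedAddCommGroup H] [NormedSpace ℝ H] {α : Type*} [MeasurableSpace α]
    {ν : Measure α} {q : ENNReal} (G : W → α → H) (hG : ∀ φ ∈ V, MemLp (G φ) q ν)
    (hadd : ∀ φ ∈ V, ∀ ψ ∈ V, G (φ + ψ) =ᵐ[ν] G φ + G ψ)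
    (hsmul : ∀ (c : ℝ), ∀ φ ∈ V, G (c • φ) =ᵐ[ν] c • G φ) :
    ∃ T : V →ₗ[ℝ] Lp H q ν, ∀ φ : V, T φ =ᵐ[ν] G φ :=
  ⟨{ toFun := fun φ => (hG φ φ.2).toLp _
     map_add' := fun φ ψ => by
      rw [← MemLp.toLp_add]
      exact MemLp.toLp_congr _ _ (hadd φ φ.2 ψ ψ.2)
     map_smul' := fun c φ => by
      rw [RingHom.id_apply, ← MemLp.toLp_const_smul]
      exact MemLp.toLp_congr _ _ (hsmul c φ φ.2) },
    fun φ => MemLp.coeFn_toLp (hG φ φ.2)⟩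

end LinearMaps

variable {n : ℕ} {E : Set (EuclideanSpace ℝ (Fin n))} {φ ψ : EuclideanSpace ℝ (Fin n) → ℝ}

/-- The closure of `E` is compact in `Ω`. Finiteness puts `L^p(v;E)` inside `L^1`, which makes the
mean linear and continuous. -/
theorem isFiniteMeasure_weightMeasure {Ω : Set (EuclideanSpace ℝ (Fin n))}
    {v : EuclideanSpace ℝ (Fin n) → ℝ} (hEb : Bornology.IsBounded E) (hEΩ : closure E ⊆ Ω)
    (hv : LocallyIntegrableOn v Ω volume) : IsFiniteMeasure (weightMeasure v E) := by
  have h1 : IntegrableOn v E volume :=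
    ((hv.mono_set hEΩ).integrableOn_isCompact hEb.isCompact_closure).mono_set subset_closure
  refine isFiniteMeasure_withDensity ?_
  refine (lt_of_le_of_lt (lintegral_mono fun x => ?_) h1.2).ne
  rw [← ofReal_norm]
  exact ENNReal.ofReal_le_ofReal (le_abs_self _)

/-! ### Linearity of `C¹(closure E)` and of the gradient. -/

section C1

theorem IsC1Closure.differentiableAt (hE : IsOpen E) (hφ : IsC1Closure E φ)
    {x : EuclideanSpace ℝ (Fin n)} (hx : x ∈ E) : DifferentiableAt ℝ φ x :=
  (hφ.1.differentiableOn one_ne_zero).differentiableAt (hE.mem_nhds hx)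

theorem IsC1Closure.gradient_add (hE : IsOpen E) (hφ : IsC1Closure E φ) (hψ : IsC1Closure E ψ) :
    Set.EqOn (gradient (φ + ψ)) (gradient φ + gradient ψ) E := fun x hx => by
  simp only [gradient, Pi.add_apply]
  rw [fderiv_add (hφ.differentiableAt hE hx) (hψ.differentiableAt hE hx), map_add]

theorem IsC1Closure.gradient_const_smul (hE : IsOpen E) (hφ : IsC1Closure E φ) (c : ℝ) :
    Set.EqOn (gradient (c • φ)) (c • gradient φ) E := fun x hx => by
  simp only [gradient, Pi.smul_apply]
  rw [fderiv_const_smul (hφ.differentiableAt hE hx) c]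
  simp

theorem IsC1Closure.add (hE : IsOpen E) (hφ : IsC1Closure E φ) (hψ : IsC1Closure E ψ) :
    IsC1Closure E (φ + ψ) := by
  obtain ⟨G, hG, hGe⟩ := hφ.2.2
  obtain ⟨G', hG', hGe'⟩ := hψ.2.2
  refine ⟨hφ.1.add hψ.1, hφ.2.1.add hψ.2.1, G + G', hG.add hG', fun x hx => ?_⟩
  rw [hφ.gradient_add hE hψ hx, Pi.add_apply, Pi.add_apply, hGe hx, hGe' hx]

theorem IsC1Closure.const_smul (hE : IsOpen E) (hφ : IsC1Closure E φ) (c : ℝ) :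
    IsC1Closure E (c • φ) := by
  obtain ⟨G, hG, hGe⟩ := hφ.2.2
  refine ⟨contDiffOn_const.smul hφ.1, hφ.2.1.const_smul c, c • G, hG.const_smul c,
    fun x hx => ?_⟩
  rw [hφ.gradient_const_smul hE c hx, Pi.smul_apply, Pi.smul_apply, hGe hx]

theorem isC1Closure_zero : IsC1Closure E (0 : EuclideanSpace ℝ (Fin n) → ℝ) :=
  ⟨contDiffOn_const, continuousOn_const, 0, continuousOn_const, fun x _ => by
    simp [gradient]⟩

end C1

/-! ### The space `𝓛^p_Q(E)` seen through `g ↦ √Q g`. -/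

variable {p : ℝ} {Q : EuclideanSpace ℝ (Fin n) → Matrix (Fin n) (Fin n) ℝ}
  {v : EuclideanSpace ℝ (Fin n) → ℝ}

/-- The vector field `√Q g`. -/
def rootField (Q : EuclideanSpace ℝ (Fin n) → Matrix (Fin n) (Fin n) ℝ)
    (g : EuclideanSpace ℝ (Fin n) → EuclideanSpace ℝ (Fin n)) :
    EuclideanSpace ℝ (Fin n) → EuclideanSpace ℝ (Fin n) :=
  fun x => act (rootMatrix (Q x)) (g x)

theorem eLpNorm_ofReal_eq {α H : Type*} [MeasurableSpace α] [NormedAddCommGroup H]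
    {ν : Measure α} (hp : 0 < p) (f : α → H) :
    eLpNorm f (ENNReal.ofReal p) ν = (∫⁻ x, ENNReal.ofReal (‖f x‖ ^ p) ∂ν) ^ (1 / p) := by
  rw [eLpNorm_eq_lintegral_rpow_enorm_toReal (by simpa using hp) ENNReal.ofReal_ne_top,
    ENNReal.toReal_ofReal hp.le]
  congr 2 with x
  rw [← ofReal_norm, ENNReal.ofReal_rpow_of_nonneg (norm_nonneg _) hp.le]

theorem normLQ_eq_eLpNorm (hp : 0 < p) (hA : ∀ᵐ x ∂volume.restrict E, (Q x).PosSemidef)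
    (g : EuclideanSpace ℝ (Fin n) → EuclideanSpace ℝ (Fin n)) :
    normLQ p Q E g = eLpNorm (rootField Q g) (ENNReal.ofReal p) (volume.restrict E) := by
  rw [eLpNorm_ofReal_eq hp, normLQ]
  congr 1
  refine lintegral_congr_ae ?_
  filter_upwards [hA] with x hx
  rw [sqrtNorm_eq_norm_act hx, rootField]

theorem MemLQ.memLp_rootField (hp : 0 < p) (hA : ∀ᵐ x ∂volume.restrict E, (Q x).PosSemidef)
    (hm : ∀ i j, AEMeasurable (fun x => Q x i j) (volume.restrict E))
    {g : EuclideanSpace ℝ (Fin n) → EuclideanSpace ℝ (Fin n)} (hg : MemLQ p Q E g) :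
    MemLp (rootField Q g) (ENNReal.ofReal p) (volume.restrict E) :=
  ⟨(aemeasurable_act (aemeasurable_rootMatrix hm (hA.mono fun _ h => h.isHermitian))
    hg.1).aestronglyMeasurable, by rw [← normLQ_eq_eLpNorm hp hA]; exact hg.2⟩

theorem normLQ_congr {g g' : EuclideanSpace ℝ (Fin n) → EuclideanSpace ℝ (Fin n)}
    (h : g =ᵐ[volume.restrict E] g') : normLQ p Q E g = normLQ p Q E g' := by
  rw [normLQ, normLQ]
  congr 1
  refine lintegral_congr_ae ?_
  filter_upwards [h] with x hx
  rw [hx]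

theorem MemLQ.congr {g g' : EuclideanSpace ℝ (Fin n) → EuclideanSpace ℝ (Fin n)}
    (hg : MemLQ p Q E g) (h : g =ᵐ[volume.restrict E] g') : MemLQ p Q E g' :=
  ⟨hg.1.congr h, by rw [← normLQ_congr h]; exact hg.2⟩

theorem MemLQ.add (hp : 0 < p) (hA : ∀ᵐ x ∂volume.restrict E, (Q x).PosSemidef)
    (hm : ∀ i j, AEMeasurable (fun x => Q x i j) (volume.restrict E))
    {g g' : EuclideanSpace ℝ (Fin n) → EuclideanSpace ℝ (Fin n)}
    (hg : MemLQ p Q E g) (hg' : MemLQ p Q E g') : MemLQ p Q E (g + g') := by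
  refine ⟨hg.1.add hg'.1, ?_⟩
  have h : rootField Q (g + g') = rootField Q g + rootField Q g' :=
    funext fun x => act_add _ _ _
  rw [normLQ_eq_eLpNorm hp hA, h]
  exact ((hg.memLp_rootField hp hA hm).add (hg'.memLp_rootField hp hA hm)).2

theorem MemLQ.const_smul (hp : 0 < p) (hA : ∀ᵐ x ∂volume.restrict E, (Q x).PosSemidef)
    (hm : ∀ i j, AEMeasurable (fun x => Q x i j) (volume.restrict E))
    {g : EuclideanSpace ℝ (Fin n) → EuclideanSpace ℝ (Fin n)}
    (hg : MemLQ p Q E g) (c : ℝ) : MemLQ p Q E (c • g) := by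
  refine ⟨hg.1.const_smul c, ?_⟩
  have h : rootField Q (c • g) = c • rootField Q g := funext fun x => act_smul _ _ _
  rw [normLQ_eq_eLpNorm hp hA, h]
  exact ((hg.memLp_rootField hp hA hm).const_smul c).2

/-- The mean-zero functions in `C¹(closure E)` of finite Sobolev norm. -/
def meanZeroC1 (hp : 1 < p) (hE : IsOpen E)
    (hA : ∀ᵐ x ∂volume.restrict E, (Q x).PosSemidef)
    (hm : ∀ i j, AEMeasurable (fun x => Q x i j) (volume.restrict E))
    [IsFiniteMeasure (weightMeasure v E)] : Submodule ℝ (EuclideanSpace ℝ (Fin n) → ℝ) where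
  carrier := {φ | IsC1FiniteNorm p v Q E φ ∧ ∫ x, φ x ∂(weightMeasure v E) = 0}
  zero_mem' := by
    refine ⟨⟨isC1Closure_zero, MemLp.zero, ?_⟩, by simp⟩
    have h : gradient (0 : EuclideanSpace ℝ (Fin n) → ℝ) = 0 := by
      funext x; simp [gradient]
    rw [h]
    refine ⟨aemeasurable_const, ?_⟩
    have h' : rootField Q 0 = 0 := funext fun x => by simp [rootField, act]
    rw [normLQ_eq_eLpNorm (by linarith) hA, h', eLpNorm_zero]
    exact ENNReal.zero_lt_top
  add_mem' := by
    rintro φ ψ ⟨⟨h1, h2, h3⟩, h4⟩ ⟨⟨k1, k2, k3⟩, k4⟩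
    refine ⟨⟨h1.add hE k1, h2.add k2, (h3.add (by linarith) hA hm k3).congr
      ((ae_restrict_mem hE.measurableSet).mono fun x hx => (h1.gradient_add hE k1 hx).symm)⟩, ?_⟩
    have hq : 1 ≤ ENNReal.ofReal p := by simpa using hp.le
    simp only [Pi.add_apply]
    rw [integral_add (h2.integrable hq) (k2.integrable hq), h4, k4, add_zero]
  smul_mem' := by
    rintro c φ ⟨⟨h1, h2, h3⟩, h4⟩
    refine ⟨⟨h1.const_smul hE c, h2.const_smul c, (h3.const_smul (by linarith) hA hm c).congr
      ((ae_restrict_mem hE.measurableSet).mono fun x hx =>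
        (h1.gradient_const_smul hE c hx).symm)⟩, ?_⟩
    simp only [Pi.smul_apply]
    rw [integral_smul, h4, smul_zero]

/-! ### Bounds for the data, recovery of `g`, and existence. -/

theorem PoincareProperty.exists_eLpNorm_le (hp : 0 < p) (hP : PoincareProperty p v Q E) :
    ∃ C : ℝ, 0 ≤ C ∧ ∀ φ, IsC1Closure E φ → ∫ x, φ x ∂(weightMeasure v E) = 0 →
      eLpNorm φ (ENNReal.ofReal p) (weightMeasure v E) ≤
        ENNReal.ofReal C * normLQ p Q E (gradient φ) := by
  obtain ⟨C, hC, h⟩ := hP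
  refine ⟨C ^ (1 / p), by positivity, fun φ hφ h0 => ?_⟩
  have h1 := h φ hφ
  simp only [average_eq, h0, smul_zero, sub_zero] at h1
  rw [eLpNorm_ofReal_eq hp, normLQ, ← ENNReal.ofReal_rpow_of_nonneg hC.le (by positivity),
    ← ENNReal.mul_rpow_of_nonneg _ _ (by positivity)]
  exact ENNReal.rpow_le_rpow h1 (by positivity)

/-- The functional `φ ↦ ∫ |f|^{p-2} f φ` is bounded on `L^p`. -/
theorem exists_abs_integral_rpow_mul_le {α : Type*} [MeasurableSpace α] {ν : Measure α}
    (hp : 1 < p) {f : α → ℝ} (hf : MemLp f (ENNReal.ofReal p) ν) :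
    ∃ K : ℝ, 0 ≤ K ∧ ∀ φ : Lp ℝ (ENNReal.ofReal p) ν,
      |∫ x, |f x| ^ (p - 2) * f x * φ x ∂ν| ≤ K * ‖φ‖ := by
  have hp0 : 0 < p := by linarith
  have hq := Real.HolderConjugate.conjExponent hp
  -- The conjugate exponent is `p / (p - 1)`, so Hölder applies to `|f|^{p-1}` and `φ`.
  have hfq : MemLp (fun x => ‖f x‖ ^ (p - 1)) (ENNReal.ofReal p.conjExponent) ν := by
    have h := hf.norm_rpow_div (ENNReal.ofReal (p - 1))
    rwa [ENNReal.toReal_ofReal (by linarith), ← ENNReal.ofReal_div_of_pos (by linarith)] at h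
  refine ⟨(∫ x, ‖‖f x‖ ^ (p - 1)‖ ^ p.conjExponent ∂ν) ^ (1 / p.conjExponent), by positivity,
    fun φ => ?_⟩
  have h1 := integral_mul_norm_le_Lp_mul_Lq hq (Lp.memLp φ) hfq
  have h2 : (∫ x, ‖φ x‖ ^ p ∂ν) ^ (1 / p) = ‖φ‖ := by
    rw [← Lp_norm_rpow hp, one_div]
    exact Real.rpow_rpow_inv ENNReal.toReal_nonneg hp0.ne'
  rw [h2, mul_comm (‖φ‖)] at h1
  rw [← Real.norm_eq_abs]
  refine le_trans ?_ h1
  refine norm_integral_le_of_norm_le ?_ (Eventually.of_forall fun x => ?_)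
  · have : (ENNReal.ofReal p).HolderConjugate (ENNReal.ofReal p.conjExponent) :=
      Real.HolderConjugate.ennrealOfReal hq
    exact (Lp.memLp φ).norm.integrable_mul hfq.norm
  · have h3 := abs_rpow_mul_inner_le hp (φ x) (f x)
    rw [Real.norm_of_nonneg (by positivity : 0 ≤ ‖f x‖ ^ (p - 1)), mul_comm ‖φ x‖]
    simpa [mul_assoc, mul_comm, mul_left_comm] using h3

/-- The range of `g ↦ √Q g` in `L^p` is closed. -/
theorem exists_rootField_eq_of_tendsto (hp : 0 < p)
    (hA : ∀ᵐ x ∂volume.restrict E, (Q x).PosSemidef)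
    (hm : ∀ i j, AEMeasurable (fun x => Q x i j) (volume.restrict E))
    {G : ℕ → EuclideanSpace ℝ (Fin n) → EuclideanSpace ℝ (Fin n)}
    {h : EuclideanSpace ℝ (Fin n) → EuclideanSpace ℝ (Fin n)}
    (hG : ∀ k, MemLQ p Q E (G k)) (hh : MemLp h (ENNReal.ofReal p) (volume.restrict E))
    (hlim : Tendsto (fun k => eLpNorm (rootField Q (G k) - h) (ENNReal.ofReal p)
      (volume.restrict E)) atTop (𝓝 0)) :
    ∃ g, MemLQ p Q E g ∧ rootField Q g =ᵐ[volume.restrict E] h := by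
  let g : EuclideanSpace ℝ (Fin n) → EuclideanSpace ℝ (Fin n) := fun x => act (rootPinv (Q x)) (h x)
  have hg : rootField Q g =ᵐ[volume.restrict E] h := by
    obtain ⟨ns, -, hns⟩ := (tendstoInMeasure_of_tendsto_eLpNorm (by simpa using hp)
      (fun k => ((hG k).memLp_rootField hp hA hm).1) hh.1 hlim).exists_seq_tendsto_ae
    filter_upwards [hns] with x hx
    -- `√Q` times its pseudoinverse fixes the range of `√Q`, hence also the pointwise limit `h x`
    -- along the subsequence.
    have h1 := ((continuous_act (rootMatrix (Q x) * rootPinv (Q x))).tendsto (h x)).comp hx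
    have h2 : (act (rootMatrix (Q x) * rootPinv (Q x)) ∘ fun k => rootField Q (G (ns k)) x) =
        fun k => rootField Q (G (ns k)) x := by
      funext k
      simp only [Function.comp, rootField, act_act, rootMatrix_mul_rootPinv_mul]
    rw [h2] at h1
    have h3 := tendsto_nhds_unique h1 hx
    simpa only [rootField, g, act_act] using h3
  refine ⟨g, ⟨aemeasurable_act (aemeasurable_rootPinv hm (hA.mono fun _ h => h.isHermitian))
    hh.1.aemeasurable, ?_⟩, hg⟩
  rw [normLQ_eq_eLpNorm hp hA, eLpNorm_congr_ae hg]
  exact hh.2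

theorem exists_isWeakSolution (hp : 1 < p) (hE : IsOpen E)
    (hA : ∀ᵐ x ∂volume.restrict E, (Q x).PosSemidef)
    (hm : ∀ i j, AEMeasurable (fun x => Q x i j) (volume.restrict E))
    [IsFiniteMeasure (weightMeasure v E)] (hP : PoincareProperty p v Q E)
    {f : EuclideanSpace ℝ (Fin n) → ℝ}
    (hf : MemLp f (ENNReal.ofReal p) (weightMeasure v E)) :
    ∃ u g, MemHTilde p v Q E u g ∧ IsWeakSolution p v Q E f g := by
  have hp0 : 0 < p := by linarith
  have hq : 1 ≤ ENNReal.ofReal p := by simpa using hp.le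
  have : Fact (1 ≤ ENNReal.ofReal p) := ⟨hq⟩
  set μ := weightMeasure v E with hμ
  set ν := volume.restrict E with hν
  let V := meanZeroC1 (v := v) hp hE hA hm
  have hV : ∀ φ ∈ V, IsC1FiniteNorm p v Q E φ ∧ ∫ x, φ x ∂μ = 0 := fun φ hφ => hφ
  have hE' : ∀ᵐ x ∂ν, x ∈ E := ae_restrict_mem hE.measurableSet
  obtain ⟨T, hT⟩ := exists_linearMap_coeFn_eq V (ν := ν) (q := ENNReal.ofReal p)
    (fun φ => rootField Q (gradient φ)) (fun φ hφ => (hV φ hφ).1.2.2.memLp_rootField hp0 hA hm)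
    (fun φ hφ ψ hψ => hE'.mono fun x hx => by
      simp only [rootField, Pi.add_apply]
      rw [(hV φ hφ).1.1.gradient_add hE (hV ψ hψ).1.1 hx, Pi.add_apply, act_add])
    (fun c φ hφ => hE'.mono fun x hx => by
      simp only [rootField, Pi.smul_apply]
      rw [(hV φ hφ).1.1.gradient_const_smul hE c hx, Pi.smul_apply, act_smul])
  obtain ⟨U, hU⟩ := exists_linearMap_coeFn_eq V (ν := μ) (q := ENNReal.ofReal p)
    (fun φ => φ) (fun φ hφ => (hV φ hφ).1.2.1) (fun _ _ _ _ => EventuallyEq.rfl)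
    (fun _ _ _ => EventuallyEq.rfl)
  obtain ⟨C, hC, hUT⟩ : ∃ C : ℝ, 0 ≤ C ∧ ∀ φ : V, ‖U φ‖ ≤ C * ‖T φ‖ := by
    obtain ⟨C, hC, h⟩ := hP.exists_eLpNorm_le hp0
    refine ⟨C, hC, fun φ => ?_⟩
    have h1 := h φ (hV φ φ.2).1.1 (hV φ φ.2).2
    rw [normLQ_eq_eLpNorm hp0 hA, ← eLpNorm_congr_ae (hT φ), ← eLpNorm_congr_ae (hU φ)] at h1
    rw [Lp.norm_def, Lp.norm_def]
    refine (ENNReal.toReal_mono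
      (ENNReal.mul_ne_top ENNReal.ofReal_ne_top (Lp.eLpNorm_ne_top _)) h1).trans ?_
    rw [ENNReal.toReal_mul, ENNReal.toReal_ofReal hC]
  have hint : ∀ φ : EuclideanSpace ℝ (Fin n) → ℝ, MemLp φ (ENNReal.ofReal p) μ →
      Integrable (fun x => |f x| ^ (p - 2) * f x * φ x) μ := fun φ hφ => by
    refine (integrable_rpow_mul_inner hp hφ hf).congr (Eventually.of_forall fun x => ?_)
    simp [mul_assoc, mul_comm, mul_left_comm]
  let ℓ : V →ₗ[ℝ] ℝ :=
    { toFun := fun φ => ∫ x, |f x| ^ (p - 2) * f x * (φ : EuclideanSpace ℝ (Fin n) → ℝ) x ∂μ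
      map_add' := fun φ ψ => by
        rw [← integral_add (hint φ (hV φ φ.2).1.2.1) (hint ψ (hV ψ ψ.2).1.2.1)]
        simp [mul_add]
      map_smul' := fun c φ => by
        rw [RingHom.id_apply, smul_eq_mul, ← integral_const_mul]
        simp [mul_left_comm] }
  obtain ⟨K, hK, hℓ⟩ := exists_abs_integral_rpow_mul_le hp hf
  have hℓT : ∀ φ, |ℓ φ| ≤ K * C * ‖T φ‖ := fun φ => by
    have h1 := hℓ (U φ)
    have h2 : ∫ x, |f x| ^ (p - 2) * f x * U φ x ∂μ = ℓ φ := by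
      refine integral_congr_ae ?_
      filter_upwards [hU φ] with x hx
      rw [hx]
    rw [h2] at h1
    rw [mul_assoc]
    exact h1.trans (mul_le_mul_of_nonneg_left (hUT φ) hK)
  obtain ⟨φ, h, hlim, hEL⟩ := exists_tendsto_eulerLagrange hp T ℓ (K * C) hℓT
  -- The Poincaré bound `hUT`, applied to differences, transfers the Cauchy property from the
  -- gradients to the functions.
  have hcauchy : CauchySeq fun k => U (φ k) := by
    refine Metric.cauchySeq_iff.2 fun δ hδ => ?_
    obtain ⟨N, hN⟩ := Metric.cauchySeq_iff.1 hlim.cauchySeq (δ / (C + 1)) (by positivity)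
    refine ⟨N, fun k hk l hl => ?_⟩
    have h1 := hN k hk l hl
    rw [dist_eq_norm, ← map_sub, lt_div_iff₀ (by positivity)] at h1
    rw [dist_eq_norm, ← map_sub]
    linarith [hUT (φ k - φ l), norm_nonneg (T (φ k - φ l))]
  obtain ⟨u, hu⟩ := cauchySeq_tendsto_of_complete hcauchy
  have hu' : Tendsto (fun k => eLpNorm ((φ k : EuclideanSpace ℝ (Fin n) → ℝ) -
      (u : EuclideanSpace ℝ (Fin n) → ℝ))
      (ENNReal.ofReal p) μ) atTop (𝓝 0) := by
    refine ((Lp.tendsto_Lp_iff_tendsto_eLpNorm' _ _).1 hu).congr fun k => ?_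
    exact eLpNorm_congr_ae ((hU (φ k)).sub EventuallyEq.rfl)
  have hh' : Tendsto (fun k => eLpNorm (rootField Q (gradient
      (φ k : EuclideanSpace ℝ (Fin n) → ℝ)) -
      (h : EuclideanSpace ℝ (Fin n) → EuclideanSpace ℝ (Fin n)))
      (ENNReal.ofReal p) ν) atTop (𝓝 0) := by
    refine ((Lp.tendsto_Lp_iff_tendsto_eLpNorm' _ _).1 hlim).congr fun k => ?_
    exact eLpNorm_congr_ae ((hT (φ k)).sub EventuallyEq.rfl)
  obtain ⟨g, hg, hgh⟩ := exists_rootField_eq_of_tendsto hp0 hA hm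
    (fun k => (hV _ (φ k).2).1.2.2) (Lp.memLp h) hh'
  refine ⟨u, g, ⟨⟨Lp.memLp u, hg, fun k => φ k, fun k => (hV _ (φ k).2).1, hu', ?_⟩, ?_⟩, ?_⟩
  · refine hh'.congr fun k => ?_
    rw [normLQ_eq_eLpNorm hp0 hA]
    refine eLpNorm_congr_ae ?_
    filter_upwards [hgh] with x hx
    rw [Pi.sub_apply, ← hx]
    simp only [rootField, Pi.sub_apply, act_sub]
  -- On a finite measure space `L^p` convergence implies `L^1` convergence, so the zero means pass
  -- to the limit.
  · have h1 : Tendsto (fun k => ∫ x, (φ k : EuclideanSpace ℝ (Fin n) → ℝ) x ∂μ) atTop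
        (𝓝 (∫ x, u x ∂μ)) := by
      refine tendsto_integral_of_L1' _ (Lp.aestronglyMeasurable u)
        (Eventually.of_forall fun k => (hV _ (φ k).2).1.2.1.integrable hq) ?_
      have h2 : Tendsto (fun k => eLpNorm ((φ k : EuclideanSpace ℝ (Fin n) → ℝ) -
      (u : EuclideanSpace ℝ (Fin n) → ℝ))
          (ENNReal.ofReal p) μ * μ Set.univ ^ (1 / (1 : ENNReal).toReal -
            1 / (ENNReal.ofReal p).toReal)) atTop (𝓝 0) := by
        have h3 := ENNReal.Tendsto.mul_const (b := μ Set.univ ^ (1 / (1 : ENNReal).toReal -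
            1 / (ENNReal.ofReal p).toReal)) hu' (Or.inr (ENNReal.rpow_ne_top_of_nonneg (by
              rw [ENNReal.toReal_one, ENNReal.toReal_ofReal hp0.le, div_one, sub_nonneg]
              exact (div_le_one hp0).2 hp.le) (measure_ne_top μ _)))
        rwa [zero_mul] at h3
      exact tendsto_of_tendsto_of_tendsto_of_le_of_le tendsto_const_nhds h2
        (fun _ => zero_le) fun k => eLpNorm_le_eLpNorm_mul_rpow_measure_univ hq
          ((hV _ (φ k).2).1.2.1.1.sub (Lp.aestronglyMeasurable u))
    simp only [fun k => (hV _ (φ k).2).2] at h1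
    exact (tendsto_nhds_unique h1 tendsto_const_nhds)
  · intro ψ hψ hψH
    -- Every admissible test function lies in the space over which `J` was minimized, so the
    -- Euler–Lagrange equation applies to it.
    have hψV : ψ ∈ V := ⟨⟨hψ, hψH.1.1, hψH.1.2.1⟩, hψH.2⟩
    have hcongr : (fun x => ‖h x‖ ^ (p - 2) * inner ℝ (T ⟨ψ, hψV⟩ x) (h x)) =ᵐ[ν]
        fun x => sqrtNorm (Q x) (g x) ^ (p - 2) * bilin (Q x) (gradient ψ x) (g x) := by
      filter_upwards [hT ⟨ψ, hψV⟩, hgh, hA] with x h1 h2 h3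
      rw [sqrtNorm_eq_norm_act h3, bilin_eq_inner_act h3, h1, ← h2]
      rfl
    refine ⟨(integrable_rpow_mul_inner hp (Lp.memLp _) (Lp.memLp h)).congr hcongr,
      hint ψ hψH.1.1, ?_⟩
    rw [← integral_congr_ae hcongr]
    exact hEL ⟨ψ, hψV⟩

end DegenerateNeumann

end

theorem theorem4p2 {n : ℕ} (Ω E : Set (EuclideanSpace ℝ (Fin n)))
    (hΩ : IsOpen Ω) (hE : IsOpen E) (hEb : Bornology.IsBounded E) (hEΩ : closure E ⊆ Ω)
    (Q : EuclideanSpace ℝ (Fin n) → Matrix (Fin n) (Fin n) ℝ)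
    (hQm : ∀ i j, AEMeasurable (fun x => Q x i j) (volume.restrict Ω))
    (hQ : ∀ x ∈ Ω, (Q x).PosSemidef)
    (v : EuclideanSpace ℝ (Fin n) → ℝ)
    (hv0 : ∀ x ∈ Ω, 0 ≤ v x) (hv : LocallyIntegrableOn v Ω volume)
    (p : ℝ) (hp : 1 < p)
    (hγ : LocallyIntegrableOn (fun x => DegenerateNeumann.opNorm (Q x) ^ (p / 2)) E volume)
    (hP : DegenerateNeumann.PoincareProperty p v Q E)
    (f : EuclideanSpace ℝ (Fin n) → ℝ)
    (hf : MemLp f (ENNReal.ofReal p) (DegenerateNeumann.weightMeasure v E)) :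
    ∃ (u : EuclideanSpace ℝ (Fin n) → ℝ)
      (g : EuclideanSpace ℝ (Fin n) → EuclideanSpace ℝ (Fin n)),
      DegenerateNeumann.MemHTilde p v Q E u g ∧
        DegenerateNeumann.IsWeakSolution p v Q E f g := by
  have hsub : E ⊆ Ω := subset_closure.trans hEΩ
  have := DegenerateNeumann.isFiniteMeasure_weightMeasure hEb hEΩ hv
  exact DegenerateNeumann.exists_isWeakSolution hp hE
    ((ae_restrict_mem hE.measurableSet).mono fun x hx => hQ x (hsub hx))
    (fun i j => (hQm i j).mono_measure (Measure.restrict_mono hsub le_rfl)) hP hf
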